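/- Conventions. All Banach spaces are real. For sets with binary relations $(U,R)$, $(V,S)$, a map $f:U\to V$ is a Tukey function if for every $v_0\in V$ there is $u_0\in U$ such that $f(u)\,S\,v_0$ implies $u\,R\,u_0$ for all $u\in U$; posets $U,V$ are Tukey equivalent, $U\sim V$, if there are Tukey functions $U\to V$ and $V\to U$. For a cardinal $\kappa$, $[\kappa]^{<\omega}$ is the set of finite subsets of $\kappa$ ordered by inclusion. An unconditional basis of a Banach space $X$ is an infinite countable set $\mathcal B\subseteq X$ of non-zero vectors with $\overline{\mathrm{span}}(\mathcal B)=X$ for which there is $C>0$ such that $\bigl\|\sum_{x\in G}\alpha(x)x\bigr\|\le C\bigl\|\sum_{x\in F}\alpha(x)x\bigr\|$ for all finite $G\subseteq F\subseteq\mathcal B$ and all $\alpha:F\to\mathbb R$; it is normalized if $\|x\|=1$ for all $x\in\mathcal B$. $\mathcal{RK}(\mathcal B)$ is the family of relatively weakly compact subsets of $\mathcal B$ (those whose weak closure in $X$ is weakly compact), ordered by inclusion. A subset of a Polish space is coanalytic if its complement is analytic. The five canonical posets are $\{0\}$, $\omega$, $\omega^\omega$ (ordered pointwise), the family $\mathcal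 K(\mathbb Q)$ of compact subsets of $\mathbb Q$ (ordered by inclusion), and $[\mathfrak c]^{<\omega}$. $MA_{\aleph_1}$ is the statement that for every non-empty partial (equivalently, pre-) order $P$ with the countable chain condition and every family of at most $\aleph_1$ dense subsets of $P$ there is a filter on $P$ meeting all of them. Lusin's hypothesis is the statement that every subset of cardinality $\omega_1$ of a Polish space is coanalytic. Theorem. (1) If there exists a coanalytic set $E\subseteq 2^\omega$ of cardinality $\omega_1$, then there is a normalized unconditional basis $\mathcal B$ of a Banach space such that $\mathcal{RK}(\mathcal B)\sim[\omega_1]^{<\omega}$. (2) Assume $MA_{\aleph_1}$ and Lusin's hypothesis. Then there exists a coanalytic set $E\subseteq 2^\omega$ of cardinality $\omega_1$ (so that a basis as in (1) exists), and for every normalized unconditional basis $\mathcal B$ of a Banach space with $\mathcal{RK}(\mathcal B)\sim[\omega_1]^{<\omega}$, the poset $\mathcal{RK}(\mathcal B)$ is not Tukey equivalent to any of the five canonical posets. -/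

import Mathlib

universe u v

section TukeyOrder

/-- `f : U → V` is a Tukey function from `(U, R)` to `(V, S)`. -/
def IsTukeyFunction {U : Type u} {V : Type v} (R : U → U → Prop) (S : V → V → Prop)
    (f : U → V) : Prop :=
  ∀ v₀ : V, ∃ u₀ : U, ∀ a : U, S (f a) v₀ → R a u₀

/-- `(U, R)` is Tukey reducible to `(V, S)`. -/
def TukeyReducible {U : Type u} {V : Type v} (R : U → U → Prop) (S : V → V → Prop) : Prop :=
  ∃ f : U → V, IsTukeyFunction R S f

/-- Tukey equivalence of two ordered sets. -/
def TukeyEquiv (U : Type u) (V : Type v) [LE U] [LE V] : Prop :=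
  TukeyReducible (fun a b : U => a ≤ b) (fun a b : V => a ≤ b) ∧
    TukeyReducible (fun a b : V => a ≤ b) (fun a b : U => a ≤ b)

/-- The set `[κ]^{<ω}` of all finite subsets of (the initial ordinal of) the cardinal `κ`,
ordered by inclusion. -/
abbrev FinSubsets (κ : Cardinal.{0}) : Type 1 :=
  Finset {α : Ordinal.{0} // α < κ.ord}

/-- `U` is Tukey equivalent to one of the posets `{0}`, `ω`, `ω^ω` (pointwise order),
`𝒦(ℚ)` (inclusion) and `[𝔠]^{<ω}` (inclusion). -/
def IsTukeyCanonical (U : Type u) [LE U] : Prop :=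
  TukeyEquiv U Unit ∨ TukeyEquiv U ℕ ∨ TukeyEquiv U (ℕ → ℕ) ∨
    TukeyEquiv U (TopologicalSpace.Compacts ℚ) ∨ TukeyEquiv U (FinSubsets Cardinal.continuum)

end TukeyOrder

section UnconditionalBases

/-- `B` is an unconditional basis of `X`: an infinite countable set of non-zero vectors with dense
linear span such that, for some constant `C`, one has
`‖∑_{x ∈ G} α(x) x‖ ≤ C ‖∑_{x ∈ F} α(x) x‖` for all finite `G ⊆ F ⊆ B` and all real `α`. -/
structure IsUnconditionalBasis {X : Type u} [NormedAddCommGroup X] [NormedSpace ℝ X]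
    (B : Set X) : Prop where
  infinite : B.Infinite
  countable : B.Countable
  ne_zero : ∀ x ∈ B, x ≠ 0
  unconditional : ∃ C : ℝ, 0 < C ∧ ∀ G F : Finset X, G ⊆ F → (F : Set X) ⊆ B → ∀ α : X → ℝ,
    ‖∑ x ∈ G, α x • x‖ ≤ C * ‖∑ x ∈ F, α x • x‖
  dense_span : (Submodule.span ℝ B).topologicalClosure = ⊤

/-- All vectors of `B` have norm one, and `B` is an unconditional basis of `X`. -/
structure IsNormalizedUnconditionalBasis {X : Type u} [NormedAddCommGroup X] [NormedSpace ℝ X]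
    (B : Set X) : Prop extends IsUnconditionalBasis B where
  norm_eq_one : ∀ x ∈ B, ‖x‖ = 1

/-- `A` is relatively weakly compact: its closure in the weak topology of `X` is compact in the
weak topology. -/
def IsRelWeaklyCompact {X : Type u} [NormedAddCommGroup X] [NormedSpace ℝ X] (A : Set X) : Prop :=
  IsCompact (closure (toWeakSpace ℝ X '' A))

/-- `ℛ𝒦(B)`: the relatively weakly compact subsets of `B`, ordered by inclusion. -/
abbrev RK {X : Type u} [NormedAddCommGroup X] [NormedSpace ℝ X] (B : Set X) : Type u :=
  {A : Set X // A ⊆ B ∧ IsRelWeaklyCompact A}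

end UnconditionalBases

section SetTheory

/-- A subset of a Polish space is coanalytic if its complement is analytic. -/
def IsCoanalytic {Z : Type u} [TopologicalSpace Z] (S : Set Z) : Prop :=
  MeasureTheory.AnalyticSet Sᶜ

/-- Two elements of a forcing notion are compatible if they have a common lower bound. -/
def ForcingCompatible {P : Type u} [Preorder P] (p q : P) : Prop :=
  ∃ r : P, r ≤ p ∧ r ≤ q

/-- The countable chain condition: every set of pairwise incompatible elements is countable. -/
def IsCCC (P : Type u) [Preorder P] : Prop :=
  ∀ A : Set P, A.Pairwise (fun p q => ¬ ForcingCompatible p q) → A.Countable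

/-- `D` is dense in the forcing notion `P`. -/
def IsForcingDense {P : Type u} [Preorder P] (D : Set P) : Prop :=
  ∀ p : P, ∃ d ∈ D, d ≤ p

/-- Martin's axiom `MA_{ℵ₁}`: for every non-empty ccc forcing notion `P` and every family of at
most `ℵ₁` dense subsets of `P` there is a filter on `P` that meets all of them. -/
def MartinAxiomAlephOne : Prop :=
  ∀ (P : Type) [Preorder P] [Nonempty P], IsCCC P →
    ∀ 𝒟 : Set (Set P), Cardinal.mk 𝒟 ≤ Cardinal.aleph 1 → (∀ D ∈ 𝒟, IsForcingDense D) →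
      ∃ G : Order.PFilter P, ∀ D ∈ 𝒟, ∃ p ∈ D, p ∈ G

/-- Lusin's hypothesis: every subset of cardinality `ω₁` of a Polish space is coanalytic. -/
def LusinHypothesis : Prop :=
  ∀ (Z : Type) [TopologicalSpace Z] [PolishSpace Z] (S : Set Z),
    Cardinal.mk S = Cardinal.aleph 1 → IsCoanalytic S

/-- There is a coanalytic subset of the Cantor space `2^ω` of cardinality `ω₁`. -/
def ExistsCoanalyticAlephOne : Prop :=
  ∃ E : Set (ℕ → Bool), IsCoanalytic E ∧ Cardinal.mk E = Cardinal.aleph 1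

end SetTheory

open Set Filter Topology

/-! ### Tukey reductions of $[\kappa]^{<\omega}$ and obstructions to them. -/

section TukeyLemmas

/-! For (1), let the complement of E be the range of a continuous f on Baire space (if E is
everything, a constant f serves). The basis is indexed by the nodes of the binary tree, and its norm
is the supremum of |sum of the coefficients over D|, where D runs over the antichains and over those
chains on branches f(z) whose k-th node has length at least z(k).

An infinite D is never relatively weakly compact (`FamilySystem.finite_of_isRelWeaklyCompact`). So a
relatively weakly compact set contains no infinite antichain and meets each branch in the range of f
finitely; compactness of the Cantor space then covers it, up to a finite set, by finitely many
branches outside that range (`exists_finite_cover_of_orthogonal`).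

Conversely, the vectors along a branch x outside the range are weakly null, because block convex
combinations on it can be made small in norm (`flattening_preimage_branchFamily`). Otherwise one
could fix the values of z one at a time while smallness keeps failing, and continuity would give
f(z) = x. The bound z(k) on lengths leaves finitely many candidates for the next value once a point
of the chain is known. As distinct branches are almost disjoint, finite sets of branches then
determine the Tukey type.

For (2), a second countable topology with bounded convergent sequences excludes the first four
canonical posets, and $\aleph_1<\mathfrak c$ excludes the last. -/

theorem TukeyReducible.trans {U V W : Type*} {R : U → U → Prop} {S : V → V → Prop}
    {T : W → W → Prop} (h₁ : TukeyReducible R S) (h₂ : TukeyReducible S T) :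
    TukeyReducible R T := by
  obtain ⟨f, hf⟩ := h₁
  obtain ⟨g, hg⟩ := h₂
  refine ⟨g ∘ f, fun w => ?_⟩
  obtain ⟨v, hv⟩ := hg w
  obtain ⟨x, hx⟩ := hf v
  exact ⟨x, fun a ha => hx a (hv _ ha)⟩

/-- A Tukey function on `[κ]^{<ω}` sends only finitely many singletons below a given element. -/
theorem IsTukeyFunction.finite_singletons {κ : Cardinal.{0}} {Q : Type*} [LE Q]
    {g : FinSubsets κ → Q}
    (hg : IsTukeyFunction (fun a b : FinSubsets κ => a ≤ b) (fun a b : Q => a ≤ b) g) (q : Q) :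
    {a | g {a} ≤ q}.Finite := by
  obtain ⟨F, hF⟩ := hg q
  refine F.finite_toSet.subset fun a ha => ?_
  exact Finset.singleton_subset_iff.1 (hF _ ha)

/-- In a second countable space, every uncountable family has a subsequence with distinct indices
that converges to a member of the family. -/
theorem exists_injective_tendsto {A Q : Type*} [TopologicalSpace Q] [SecondCountableTopology Q]
    [Uncountable A] (h : A → Q) :
    ∃ a : A, ∃ s : ℕ → A, Function.Injective s ∧ Tendsto (h ∘ s) atTop (𝓝 (h a)) := by
  -- A condensation point exists: otherwise countably many open sets with countable preimages would
  -- cover the range.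
  obtain ⟨a, ha⟩ : ∃ a, ∀ U : Set Q, IsOpen U → h a ∈ U → ¬ (h ⁻¹' U).Countable := by
    by_contra! hcon
    choose U hU haU hc using hcon
    obtain ⟨T, hT, hTU⟩ := TopologicalSpace.isOpen_iUnion_countable U hU
    have : (⋃ a ∈ T, h ⁻¹' U a).Countable := hT.biUnion fun a _ => hc a
    refine not_countable_univ (α := A) (this.mono fun b _ => ?_)
    have hb : h b ∈ ⋃ a ∈ T, U a := hTU ▸ mem_iUnion.2 ⟨b, haU b⟩
    simpa using hb
  refine ⟨a, ?_⟩
  obtain ⟨V, hV⟩ := (𝓝 (h a)).exists_antitone_basis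
  have key : ∀ n, (h ⁻¹' V n).Infinite := fun n hfin => by
    obtain ⟨U, hUV, hU, haU⟩ := mem_nhds_iff.1 (hV.mem n)
    exact ha U hU haU (hfin.countable.mono (preimage_mono hUV))
  have step : ∀ (n : ℕ) (F : Finset A), ∃ b, b ∈ h ⁻¹' V n ∧ b ∉ F := fun n F =>
    (key n).exists_notMem_finset F
  obtain ⟨s, hsV, hs⟩ := exists_seq_of_forall_finset_exists (fun b : ℕ × A => h b.2 ∈ V b.1)
    (fun b c => b.1 < c.1 ∧ b.2 ≠ c.2) (fun F _ => by
      classical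
      obtain ⟨b, hb, hbF⟩ := step (F.sup Prod.fst + 1) (F.image Prod.snd)
      refine ⟨(F.sup Prod.fst + 1, b), hb, fun x hx => ⟨?_, ?_⟩⟩
      · exact Nat.lt_succ_of_le (Finset.le_sup (f := Prod.fst) hx)
      · rintro rfl
        exact hbF (Finset.mem_image_of_mem _ hx))
  refine ⟨fun n => (s n).2, fun m n hmn => by
    by_contra hne
    rcases Nat.lt_or_gt_of_ne hne with hlt | hlt
    · exact (hs _ _ hlt).2 hmn
    · exact (hs _ _ hlt).2 hmn.symm, ?_⟩
  refine hV.toHasBasis.tendsto_right_iff.2 fun n _ => ?_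
  filter_upwards [eventually_ge_atTop n] with k hk
  have hmono : StrictMono fun n => (s n).1 := fun m n hmn => (hs m n hmn).1
  exact hV.antitone (hk.trans (hmono.id_le k)) (hsV k)

theorem mk_ordinals_lt_ord (κ : Cardinal.{0}) :
    Cardinal.mk {α : Ordinal.{0} // α < κ.ord} = Cardinal.lift.{1} κ := by
  have := Cardinal.mk_Iio_ordinal κ.ord
  rwa [Cardinal.card_ord] at this

/-- If a second countable topology makes the ranges of convergent sequences bounded, then
`[ω₁]^{<ω}` is not Tukey reducible to the poset. -/
theorem not_tukeyReducible_finSubsets_aleph_one {Q : Type*} [Preorder Q] [TopologicalSpace Q]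
    [SecondCountableTopology Q]
    (hb : ∀ (s : ℕ → Q) (q : Q), Tendsto s atTop (𝓝 q) → BddAbove (range s)) :
    ¬ TukeyReducible (fun a b : FinSubsets (Cardinal.aleph 1) => a ≤ b)
      (fun a b : Q => a ≤ b) := by
  rintro ⟨g, hg⟩
  have : Uncountable {α : Ordinal.{0} // α < (Cardinal.aleph 1).ord} := by
    rw [← Cardinal.aleph0_lt_mk_iff, mk_ordinals_lt_ord]
    simp
  obtain ⟨a, s, hs, hlim⟩ := exists_injective_tendsto fun a => g {a}
  obtain ⟨q, hq⟩ := hb _ _ hlim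
  refine infinite_range_of_injective hs ((hg.finite_singletons q).subset ?_)
  rintro _ ⟨n, rfl⟩
  exact hq ⟨n, rfl⟩

theorem not_tukeyReducible_unit :
    ¬ TukeyReducible (fun a b : FinSubsets (Cardinal.aleph 1) => a ≤ b)
      (fun a b : Unit => a ≤ b) :=
  not_tukeyReducible_finSubsets_aleph_one fun _ _ _ => ⟨(), fun _ _ => le_rfl⟩

theorem not_tukeyReducible_nat :
    ¬ TukeyReducible (fun a b : FinSubsets (Cardinal.aleph 1) => a ≤ b)
      (fun a b : ℕ => a ≤ b) :=
  not_tukeyReducible_finSubsets_aleph_one fun _ _ h => h.bddAbove_range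

theorem not_tukeyReducible_nat_fun :
    ¬ TukeyReducible (fun a b : FinSubsets (Cardinal.aleph 1) => a ≤ b)
      (fun a b : ℕ → ℕ => a ≤ b) := by
  refine not_tukeyReducible_finSubsets_aleph_one fun s q h => ?_
  have := fun i => ((tendsto_pi_nhds.1 h i).bddAbove_range : BddAbove (range fun n => s n i))
  choose b hb using this
  refine ⟨b, ?_⟩
  rintro _ ⟨n, rfl⟩ i
  exact hb i ⟨n, rfl⟩

/-- In the hyperspace of compact sets, a convergent sequence with its limit is compact, and the
union of a compact family of compact sets is compact, hence an upper bound. -/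
theorem not_tukeyReducible_compacts_rat :
    ¬ TukeyReducible (fun a b : FinSubsets (Cardinal.aleph 1) => a ≤ b)
      (fun a b : TopologicalSpace.Compacts ℚ => a ≤ b) := by
  refine not_tukeyReducible_finSubsets_aleph_one fun s q h => ?_
  refine ⟨⟨_, TopologicalSpace.Compacts.isCompact_biUnion_coe_of_isCompact
    h.isCompact_insert_range⟩, ?_⟩
  rintro _ ⟨n, rfl⟩
  exact subset_biUnion_of_mem (u := fun K : TopologicalSpace.Compacts ℚ => (K : Set ℚ))
    (mem_insert_of_mem _ ⟨n, rfl⟩)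

/-- A Tukey reduction of `[κ]^{<ω}` to `[μ]^{<ω}` with `μ` infinite forces `κ ≤ μ`. -/
theorem TukeyReducible.le_of_finSubsets {κ μ : Cardinal.{0}} (hμ : Cardinal.aleph0 ≤ μ)
    (h : TukeyReducible (fun a b : FinSubsets κ => a ≤ b) (fun a b : FinSubsets μ => a ≤ b)) :
    κ ≤ μ := by
  obtain ⟨g, hg⟩ := h
  have hinf : Infinite {α : Ordinal.{0} // α < μ.ord} := by
    rw [Cardinal.infinite_iff, mk_ordinals_lt_ord]
    simpa using hμ
  by_contra! hlt
  have hlt' : Cardinal.mk (FinSubsets μ) < Cardinal.mk {α : Ordinal.{0} // α < κ.ord} := by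
    rw [Cardinal.mk_finset_of_infinite, mk_ordinals_lt_ord, mk_ordinals_lt_ord]
    simpa using hlt
  have : Infinite {α : Ordinal.{0} // α < κ.ord} := by
    rw [Cardinal.infinite_iff]
    exact (Cardinal.infinite_iff.1 (inferInstance : Infinite (FinSubsets μ))).trans hlt'.le
  -- Pigeonhole: $[\mu]^{<\omega}$ has only μ elements, so infinitely many singletons share a value.
  obtain ⟨q, hq⟩ := Cardinal.exists_infinite_fiber (fun a => g {a}) hlt'
  rw [Set.infinite_coe_iff] at hq
  refine hq ((hg.finite_singletons q).subset fun a ha => ?_)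
  exact le_of_eq ha

end TukeyLemmas

/-! ### Consequences of Martin's axiom and Lusin's hypothesis. -/

section MartinAxiom

/-- Cohen conditions: finite binary strings, where longer strings are stronger. -/
structure CohenCondition where
  /-- The underlying string. -/
  toList : List Bool

instance : Preorder CohenCondition where
  le p q := q.toList <+: p.toList
  le_refl p := List.prefix_refl _
  le_trans p q r h₁ h₂ := h₂.trans h₁

theorem CohenCondition.toList_injective : Function.Injective CohenCondition.toList := by
  rintro ⟨p⟩ ⟨q⟩ h
  exact congrArg _ h

instance : Countable CohenCondition := CohenCondition.toList_injective.countable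

instance : Nonempty CohenCondition := ⟨⟨[]⟩⟩

/-- The Cohen conditions that disagree with `x`. -/
def CohenCondition.disagree (x : ℕ → Bool) : Set CohenCondition :=
  {p | ∃ i, p.toList[i]? = some (!x i)}

theorem CohenCondition.isForcingDense_disagree (x : ℕ → Bool) :
    IsForcingDense (CohenCondition.disagree x) := by
  intro p
  exact ⟨⟨p.toList ++ [!x p.toList.length]⟩, ⟨p.toList.length, by simp⟩, List.prefix_append _ _⟩

/-- Martin's axiom for `ℵ₁` refutes the continuum hypothesis. -/
theorem MartinAxiomAlephOne.aleph_one_lt_continuum (hMA : MartinAxiomAlephOne) :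
    Cardinal.aleph.{0} 1 < Cardinal.continuum.{0} := by
  by_contra! hle
  obtain ⟨G, hG⟩ := hMA CohenCondition (fun A _ => A.to_countable)
    (range CohenCondition.disagree)
    (Cardinal.mk_range_le.trans (by simpa using hle))
    (by rintro _ ⟨x, rfl⟩; exact CohenCondition.isForcingDense_disagree x)
  classical
  -- The real read off from G, false where G decides nothing; yet G contains a condition disagreeing
  -- with it.
  let x : ℕ → Bool := fun i => decide (∃ p ∈ G, p.toList[i]? = some true)
  obtain ⟨p, ⟨i, hi⟩, hpG⟩ := hG _ ⟨x, rfl⟩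
  cases hx : x i with
  | false =>
    have : ¬ ∃ p ∈ G, p.toList[i]? = some true := by simpa [x] using hx
    exact this ⟨p, hpG, by simpa [hx] using hi⟩
  | true =>
    obtain ⟨q, hqG, hq⟩ : ∃ p ∈ G, p.toList[i]? = some true := by simpa [x] using hx
    obtain ⟨r, _, hrp, hrq⟩ := G.directed _ hpG _ hqG
    have hpre : ∀ {a b : CohenCondition} {c : Bool}, a ≤ b → b.toList[i]? = some c →
        a.toList[i]? = some c := by
      rintro a b c ⟨l, hl⟩ hb
      rw [← hl, List.getElem?_append_left (List.getElem?_eq_some_iff.1 hb).1, hb]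
    have h₁ := hpre hrp hi
    have h₂ := hpre hrq hq
    rw [h₁, hx] at h₂
    simp at h₂

theorem LusinHypothesis.existsCoanalyticAlephOne (hL : LusinHypothesis) :
    ExistsCoanalyticAlephOne := by
  have hle : Cardinal.aleph 1 ≤ Cardinal.mk (ℕ → Bool) := by
    simpa using Cardinal.aleph_one_le_continuum
  obtain ⟨E, hE⟩ := Cardinal.le_mk_iff_exists_set.1 hle
  have : TopologicalSpace.IsCompletelyMetrizableSpace (ℕ → Bool) :=
    TopologicalSpace.IsCompletelyMetrizableSpace.pi_countable
  exact ⟨E, hL _ E hE, hE⟩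

end MartinAxiom

/-- Martin's axiom is needed only for $[\mathfrak c]^{<\omega}$, through $\aleph_1<\mathfrak c$. -/
theorem not_isTukeyCanonical_of_tukeyEquiv (hMA : MartinAxiomAlephOne) {Q : Type*} [LE Q]
    (h : TukeyEquiv Q (FinSubsets (Cardinal.aleph 1))) : ¬ IsTukeyCanonical Q := by
  rintro (h' | h' | h' | h' | h')
  · exact not_tukeyReducible_unit (h.2.trans h'.1)
  · exact not_tukeyReducible_nat (h.2.trans h'.1)
  · exact not_tukeyReducible_nat_fun (h.2.trans h'.1)
  · exact not_tukeyReducible_compacts_rat (h.2.trans h'.1)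
  · exact (TukeyReducible.le_of_finSubsets (Cardinal.aleph0_le_aleph 1)
      (h'.2.trans h.1)).not_gt hMA.aleph_one_lt_continuum

/-! ### Block convex combinations with small mass on a family of sets. -/

section Blocks

/-- The mass that a finitely supported function assigns to the set `D`. -/
noncomputable def massOn {ι : Type*} (D : Set ι) : (ι →₀ ℝ) →ₗ[ℝ] ℝ :=
  Finsupp.linearCombination ℝ (D.indicator 1)

theorem massOn_apply {ι : Type*} (D : Set ι) (v : ι →₀ ℝ) :
    massOn D v = ∑ i ∈ v.support, v i * D.indicator 1 i := rfl

theorem massOn_single {ι : Type*} (D : Set ι) (i : ι) :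
    massOn D (Finsupp.single i 1) = D.indicator 1 i := by
  simp [massOn]

/-- Probability vectors on `ℕ` supported in `[M, ∞)`. -/
def probFrom (M : ℕ) : Set (ℕ →₀ ℝ) :=
  {v | 0 ≤ v ∧ massOn univ v = 1 ∧ ∀ n < M, v n = 0}

theorem convex_probFrom (M : ℕ) : Convex ℝ (probFrom M) := by
  rintro v ⟨hv, hv1, hvM⟩ w ⟨hw, hw1, hwM⟩ a b ha hb hab
  refine ⟨?_, ?_, fun n hn => ?_⟩
  · intro n
    have h₁ := hv n
    have h₂ := hw n
    simp only [Finsupp.coe_zero, Pi.zero_apply] at h₁ h₂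
    simp only [Finsupp.coe_add, Finsupp.coe_smul, Pi.add_apply, Pi.smul_apply, smul_eq_mul,
      Finsupp.coe_zero, Pi.zero_apply]
    positivity
  · simp [hv1, hw1, hab]
  · simp [hvM n hn, hwM n hn]

theorem probFrom_anti {M N : ℕ} (h : M ≤ N) : probFrom N ⊆ probFrom M :=
  fun _ hv => ⟨hv.1, hv.2.1, fun n hn => hv.2.2 n (hn.trans_le h)⟩

theorem massOn_nonneg {v : ℕ →₀ ℝ} (hv : 0 ≤ v) (D : Set ℕ) : 0 ≤ massOn D v := by
  rw [massOn_apply]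
  exact Finset.sum_nonneg fun i _ => mul_nonneg (hv i) (indicator_nonneg (fun _ _ => zero_le_one) i)

theorem massOn_mono {v : ℕ →₀ ℝ} (hv : 0 ≤ v) {D D' : Set ℕ} (h : D ⊆ D') :
    massOn D v ≤ massOn D' v := by
  simp only [massOn_apply]
  exact Finset.sum_le_sum fun i _ => mul_le_mul_of_nonneg_left
    (indicator_le_indicator_of_subset h (fun _ => zero_le_one) i) (hv i)

theorem massOn_congr {v : ℕ →₀ ℝ} {D D' : Set ℕ} (h : ∀ n, v n ≠ 0 → (n ∈ D ↔ n ∈ D')) :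
    massOn D v = massOn D' v := by
  classical
  simp only [massOn_apply]
  refine Finset.sum_congr rfl fun i hi => ?_
  simp only [indicator_apply, h i (Finsupp.mem_support_iff.1 hi)]

theorem convexHull_range_subset_probFrom {u : ℕ → ℕ →₀ ℝ} {M : ℕ}
    (hu : ∀ n, u n ∈ probFrom M) : convexHull ℝ (range u) ⊆ probFrom M :=
  convexHull_min (range_subset_iff.2 hu) (convex_probFrom M)

theorem convex_massOn_le (F : Set (Set ℕ)) (δ : ℝ) :
    Convex ℝ {v : ℕ →₀ ℝ | ∀ D ∈ F, massOn D v ≤ δ} := by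
  simp only [ofPred_forall]
  exact convex_iInter₂ fun D _ => convex_halfSpace_le (massOn D).isLinear δ

/-- A family of sets of natural numbers is flattening if every block sequence of probability vectors
has convex combinations that are uniformly small on the family. -/
def Flattening (F : Set (Set ℕ)) : Prop :=
  ∀ u : ℕ → ℕ →₀ ℝ, (∀ M, u M ∈ probFrom M) → ∀ δ > 0,
    ∃ v ∈ convexHull ℝ (range u), ∀ D ∈ F, massOn D v ≤ δ

theorem Flattening.mono {F G : Set (Set ℕ)} (hG : Flattening G) (h : F ⊆ G) : Flattening F :=
  fun u hu δ hδ => by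
    obtain ⟨v, hv, hvG⟩ := hG u hu δ hδ
    exact ⟨v, hv, fun D hD => hvG D (h hD)⟩

theorem flattening_singleton_empty : Flattening {∅} := fun u _ δ hδ =>
  ⟨u 0, subset_convexHull ℝ _ ⟨0, rfl⟩, by simp [massOn_apply, hδ.le]⟩

theorem Flattening.exists_tail {F : Set (Set ℕ)} (hF : Flattening F) {u : ℕ → ℕ →₀ ℝ}
    (hu : ∀ M, u M ∈ probFrom M) {δ : ℝ} (hδ : 0 < δ) (M : ℕ) :
    ∃ v ∈ convexHull ℝ (range u), v ∈ probFrom M ∧ ∀ D ∈ F, massOn D v ≤ δ := by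
  obtain ⟨v, hv, hvF⟩ := hF (fun n => u (n + M))
    (fun n => probFrom_anti (Nat.le_add_right n M) (hu _)) δ hδ
  refine ⟨v, convexHull_mono (range_subset_iff.2 fun n => mem_range_self (n + M)) hv,
    convexHull_range_subset_probFrom (fun n => ?_) hv, hvF⟩
  exact probFrom_anti (Nat.le_add_left M n) (hu _)

/-- Flattening every tail for F gives a new block sequence, which is then flattened for G; the bound
on F survives convex combinations. -/
theorem Flattening.union {F G : Set (Set ℕ)} (hF : Flattening F) (hG : Flattening G) :
    Flattening (F ∪ G) := by
  intro u hu δ hδ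
  choose v hvu hv hvF using hF.exists_tail hu hδ
  obtain ⟨w, hw, hwG⟩ := hG v hv δ hδ
  have hwu := convexHull_min (range_subset_iff.2 hvu) (convex_convexHull ℝ _) hw
  have hwF := convexHull_min (range_subset_iff.2 hvF) (convex_massOn_le F δ) hw
  exact ⟨w, hwu, fun D hD => hD.elim (hwF D) (hwG D)⟩

theorem Flattening.iUnion_le {G : ℕ → Set (Set ℕ)} (hG : ∀ i, Flattening (G i)) (m : ℕ) :
    Flattening (⋃ i ≤ m, G i) := by
  induction m with
  | zero => simpa using hG 0
  | succ m ih => simpa [Set.biUnion_le_succ] using ih.union (hG (m + 1))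

/-- The inductive step: if every member of `F` that meets `[0, p]` becomes a member of one of
`G 0, …, G p` once a point of `[0, p]` is deleted, and all `G i` are flattening, then so is `F`. -/
theorem Flattening.of_sdiff {F : Set (Set ℕ)} {G : ℕ → Set (Set ℕ)} (hG : ∀ i, Flattening (G i))
    (h : ∀ D ∈ F, ∀ p ∈ D, ∃ i ≤ p, ∃ q ≤ p, D \ {q} ∈ G i) : Flattening F := by
  intro u hu δ hδ
  have hδ2 : 0 < δ / 2 := by positivity
  choose Y hYu hY hYG using fun M => (Flattening.iUnion_le hG M).exists_tail hu hδ2 M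
  -- Each block starts beyond the support of the previous one.
  let M : ℕ → ℕ := fun j => Nat.rec 0 (fun _ m => (Y m).support.sup id + m + 1) j
  have hM : ∀ j, M (j + 1) = (Y (M j)).support.sup id + M j + 1 := fun j => rfl
  have hmono : StrictMono M := strictMono_nat_of_lt_succ fun j => by rw [hM]; omega
  have hsupp : ∀ j l p, j < l → Y (M j) p ≠ 0 → p < M l := by
    intro j l p hjl hp
    have h₁ : p ≤ (Y (M j)).support.sup id :=
      Finset.le_sup (f := id) (Finsupp.mem_support_iff.2 hp)
    have h₂ := hmono.monotone (Nat.succ_le_of_lt hjl)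
    rw [Nat.succ_eq_add_one, hM] at h₂
    omega
  obtain ⟨N, hN⟩ := exists_nat_gt (2 / δ)
  have hN0 : (0 : ℝ) < N := lt_trans (by positivity) hN
  have hbound : ∀ D ∈ F, ∑ j ∈ Finset.range N, massOn D (Y (M j)) ≤ 1 + N * (δ / 2) := by
    intro D hD
    by_cases hmeet : ∃ j, ∃ p ∈ D, Y (M j) p ≠ 0
    · classical
      have hmin := fun j => Nat.find_min (m := j) hmeet
      -- Only the first block that D meets can carry large mass, at most 1. Later blocks lie beyond
      -- p, so they do not see q and are already small on `G i`. Averaging N blocks leaves at most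
      -- 1/N + δ/2.
      obtain ⟨p, hpD, hp⟩ := Nat.find_spec hmeet
      set j₀ := Nat.find hmeet
      obtain ⟨i, hip, q, hqp, hDq⟩ := h D hD p hpD
      calc ∑ j ∈ Finset.range N, massOn D (Y (M j))
          ≤ ∑ j ∈ Finset.range N, ((if j = j₀ then 1 else 0) + δ / 2) := by
            refine Finset.sum_le_sum fun j _ => ?_
            rcases lt_trichotomy j j₀ with hj | rfl | hj
            · have : massOn D (Y (M j)) = massOn ∅ (Y (M j)) := massOn_congr fun n hn =>
                ⟨fun hnD => (hmin j hj ⟨n, hnD, hn⟩).elim, fun h => h.elim⟩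
              rw [this, if_neg hj.ne]
              simp [massOn_apply, hδ2.le]
            · rw [if_pos rfl, ← (hY (M j₀)).2.1]
              have := massOn_mono (hY (M j₀)).1 (subset_univ D)
              linarith
            · rw [if_neg hj.ne', zero_add]
              have hpM := hsupp _ _ p hj hp
              have : massOn D (Y (M j)) = massOn (D \ {q}) (Y (M j)) := massOn_congr fun n hn => by
                have : n ≠ q := by
                  rintro rfl
                  exact hn ((hY (M j)).2.2 _ (hqp.trans_lt hpM))
                simp [this]
              rw [this]
              exact hYG _ _ (mem_iUnion₂.2 ⟨i, (hip.trans_lt hpM).le, hDq⟩)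
        _ ≤ 1 + N * (δ / 2) := by
            rw [Finset.sum_add_distrib, Finset.sum_ite_eq']
            simp only [Finset.sum_const, Finset.card_range, nsmul_eq_mul]
            gcongr
            split_ifs <;> norm_num
    · push Not at hmeet
      have : ∀ j, massOn D (Y (M j)) = 0 := fun j => by
        rw [massOn_congr (D' := ∅) fun n hn => ⟨fun hnD => hn (hmeet j n hnD), fun h => h.elim⟩]
        simp [massOn_apply]
      simp only [this, Finset.sum_const_zero]
      positivity
  refine ⟨∑ j ∈ Finset.range N, (1 / N : ℝ) • Y (M j), ?_, fun D hD => ?_⟩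
  · refine (convex_convexHull ℝ _).sum_mem (fun _ _ => by positivity) ?_ fun j _ => hYu _
    simp [hN0.ne']
  · simp only [map_sum, map_smul, smul_eq_mul]
    rw [← Finset.mul_sum, one_div, inv_mul_le_iff₀ hN0]
    have := hbound D hD
    have h2 : 2 < N * δ := by rwa [div_lt_iff₀ hδ] at hN
    linarith

theorem flattening_subsingleton : Flattening {D : Set ℕ | D.Subsingleton} := by
  refine Flattening.of_sdiff (G := fun _ => {∅}) (fun _ => flattening_singleton_empty) ?_
  intro D hD p hp
  refine ⟨p, le_rfl, p, le_rfl, ?_⟩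
  rw [mem_singleton_iff, sdiff_eq_empty]
  exact fun n hn => hD hn hp

end Blocks

/-! ### Initial segments and branches of the binary tree. -/

section Branches

/-- The initial segment of length `n` of the sequence `x`. -/
def initSeg (x : ℕ → Bool) (n : ℕ) : List Bool := (List.range n).map x

/-- The branch of the binary tree given by `x`. -/
def branch (x : ℕ → Bool) : Set (List Bool) := range (initSeg x)

@[simp] theorem length_initSeg (x : ℕ → Bool) (n : ℕ) : (initSeg x n).length = n := by
  simp [initSeg]

theorem initSeg_injective (x : ℕ → Bool) : Function.Injective (initSeg x) := fun m n h => by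
  simpa using congrArg List.length h

theorem initSeg_eq_iff {x y : ℕ → Bool} {n : ℕ} :
    initSeg x n = initSeg y n ↔ ∀ k < n, x k = y k := by
  simp [initSeg]

theorem initSeg_prefix (x : ℕ → Bool) {m n : ℕ} (h : m ≤ n) : initSeg x m <+: initSeg x n := by
  obtain ⟨k, rfl⟩ := Nat.exists_eq_add_of_le h
  rw [initSeg, initSeg, List.range_add, List.map_append]
  exact List.prefix_append _ _

theorem initSeg_eq_of_eq {x y : ℕ → Bool} {m n : ℕ} (h : initSeg x m = initSeg y n) : m = n := by
  simpa using congrArg List.length h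

theorem exists_initSeg_eq (l : List Bool) : ∃ x, initSeg x l.length = l := by
  refine ⟨fun i => l.getD i false, List.ext_getElem (by simp) fun i h₁ h₂ => ?_⟩
  simp [initSeg, h₂]

theorem branch_inter_branch_finite {x y : ℕ → Bool} (h : x ≠ y) :
    (branch x ∩ branch y).Finite := by
  obtain ⟨k, hk⟩ := Function.ne_iff.1 h
  refine ((finite_Iic k).image (initSeg x)).subset ?_
  rintro _ ⟨⟨m, rfl⟩, n, hn⟩
  refine ⟨m, ?_, rfl⟩
  obtain rfl := initSeg_eq_of_eq hn
  by_contra hlt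
  exact hk (initSeg_eq_iff.1 hn k (by simpa using hlt)).symm

theorem branch_infinite (x : ℕ → Bool) : (branch x).Infinite :=
  infinite_range_of_injective (initSeg_injective x)

theorem isOpen_initSeg_eq (y : ℕ → Bool) (n : ℕ) : IsOpen {x | initSeg x n = initSeg y n} := by
  simp only [initSeg_eq_iff]
  exact PiNat.isOpen_cylinder (fun _ => Bool) y n

theorem Continuous.exists_initSeg_eq {f : (ℕ → ℕ) → ℕ → Bool} (hf : Continuous f) (z : ℕ → ℕ)
    (M : ℕ) :
    ∃ n, ∀ w : ℕ → ℕ, (∀ k < n, w k = z k) → initSeg (f w) M = initSeg (f z) M := by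
  obtain ⟨_, ⟨y, n, rfl⟩, hzy, hsub⟩ :=
    (PiNat.isTopologicalBasis_cylinders fun _ => ℕ).exists_subset_of_mem_open
      (show z ∈ f ⁻¹' {x | initSeg x M = initSeg (f z) M} from rfl)
      ((isOpen_initSeg_eq (f z) M).preimage hf)
  exact ⟨n, fun w hw => hsub fun k hk => (hw k hk).trans (hzy k hk)⟩

end Branches

/-! ### Antichains, sparse chains and their traces on branches. -/

section BranchFamilies

/-- A set of binary strings without infinite antichains is covered, up to a finite set, by finitely
many branches. -/
theorem exists_finite_branches_cover {A : Set (List Bool)}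
    (hA : ∀ D ⊆ A, IsAntichain (· <+: ·) D → D.Finite) :
    ∃ Y : Set (ℕ → Bool), Y.Finite ∧ (A \ ⋃ y ∈ Y, branch y).Finite := by
  have key : ∀ y : ℕ → Bool, ∃ n, ∀ a ∈ A, initSeg y n <+: a → a ∈ branch y := by
    intro y
    by_contra! hcon
    choose a haA hpre hay using hcon
    have hlen : ∀ n, n ≤ (a n).length := fun n => by simpa using (hpre n).length_le
    -- Each chosen string agrees with y up to the length of the previous one, which is off the
    -- branch y and hence not its prefix. This yields an infinite antichain.
    let N : ℕ → ℕ := fun j => Nat.rec 0 (fun _ m => (a m).length) j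
    have hN : ∀ j, N (j + 1) = (a (N j)).length := fun j => rfl
    have hNmono : StrictMono N := by
      refine strictMono_nat_of_lt_succ fun j => ?_
      rw [hN]
      refine lt_of_le_of_ne (hlen _) fun h => hay (N j) ⟨N j, ?_⟩
      exact (hpre (N j)).eq_of_length (by simpa using h)
    have hanti : ∀ i j, i < j → ¬ (a (N i) <+: a (N j)) := by
      intro i j hij hp
      refine hay (N i) ⟨(a (N i)).length, ?_⟩
      have h₁ : initSeg y (a (N i)).length <+: a (N j) :=
        (initSeg_prefix y (by rw [← hN]; exact hNmono.monotone hij)).trans (hpre (N j))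
      exact (List.prefix_of_prefix_length_le h₁ hp (by simp)).eq_of_length (by simp)
    have hlt : StrictMono fun j => (a (N j)).length := fun i j hij => hNmono (Nat.succ_lt_succ hij)
    refine infinite_range_of_injective (f := fun j => a (N j))
      (fun i j h => hlt.injective (congrArg List.length h)) (hA _ ?_ ?_)
    · rintro _ ⟨j, rfl⟩
      exact haA _
    · rintro _ ⟨i, rfl⟩ _ ⟨j, rfl⟩ hne hp
      rcases lt_trichotomy i j with h | rfl | h
      · exact hanti i j h hp
      · exact hne rfl
      · exact (hlt h).not_ge hp.length_le
  choose n hn using key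
  obtain ⟨Y, hY⟩ := CompactSpace.elim_nhds_subcover (X := ℕ → Bool)
    (fun y => {x | initSeg x (n y) = initSeg y (n y)}) fun y => (isOpen_initSeg_eq y (n y)).mem_nhds rfl
  refine ⟨Y, Y.finite_toSet, ?_⟩
  -- A longer string of A extends one of the finitely many cylinder stems, so it lies on that
  -- branch.
  refine (List.finite_length_lt Bool (Y.sup n)).subset ?_
  rintro a ⟨haA, ha⟩
  by_contra hlen
  obtain ⟨x, hx⟩ := exists_initSeg_eq a
  have hxY : x ∈ ⋃ y ∈ Y, {x | initSeg x (n y) = initSeg y (n y)} := hY ▸ mem_univ x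
  obtain ⟨y, hyY, hxy⟩ := mem_iUnion₂.1 hxY
  refine ha (mem_iUnion₂.2 ⟨y, hyY, hn y a haA ?_⟩)
  rw [← hxy, ← hx]
  refine initSeg_prefix x ((Finset.le_sup hyY).trans ?_)
  simpa using hlen

/-- Sets of initial segments of members `f z` of the range of `f` which are sparse in the sense
that their `k`-th elements have length at least `z k`. -/
def sparseChains (f : (ℕ → ℕ) → ℕ → Bool) : Set (Set (List Bool)) :=
  {D | ∃ z φ : ℕ → ℕ, StrictMono φ ∧ (∀ k, z k ≤ φ k) ∧ D ⊆ range fun k => initSeg (f z) (φ k)}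

/-- The antichains of the binary tree, and the sparse chains along the range of `f`. -/
def branchFamily (f : (ℕ → ℕ) → ℕ → Bool) : Set (Set (List Bool)) :=
  {D | IsAntichain (· <+: ·) D} ∪ sparseChains f

theorem branchFamily_mono {f : (ℕ → ℕ) → ℕ → Bool} {D D' : Set (List Bool)}
    (hD : D ∈ branchFamily f) (h : D' ⊆ D) : D' ∈ branchFamily f := by
  rcases hD with hD | ⟨z, φ, hφ, hz, hD⟩
  · exact Or.inl (IsAntichain.subset hD h)
  · exact Or.inr ⟨z, φ, hφ, hz, h.trans hD⟩

theorem singleton_mem_branchFamily (f : (ℕ → ℕ) → ℕ → Bool) (a : List Bool) :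
    {a} ∈ branchFamily f :=
  Or.inl (IsAntichain.singleton)

theorem exists_infinite_mem_sparseChains {f : (ℕ → ℕ) → ℕ → Bool} {z : ℕ → ℕ}
    {S : Set (List Bool)} (hS : (S ∩ branch (f z)).Infinite) :
    ∃ D ∈ sparseChains f, D ⊆ S ∧ D.Infinite := by
  have hS' : {n | initSeg (f z) n ∈ S}.Infinite := by
    intro hfin
    refine hS ((hfin.image (initSeg (f z))).subset ?_)
    rintro _ ⟨h, n, rfl⟩
    exact ⟨n, h, rfl⟩
  obtain ⟨φ, hφ, hP⟩ := extraction_forall_of_frequently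
    (P := fun k n => initSeg (f z) n ∈ S ∧ z k ≤ n) fun k =>
      (Nat.frequently_atTop_iff_infinite.2 hS').and_eventually (eventually_ge_atTop (z k))
  refine ⟨_, ⟨z, φ, hφ, fun k => (hP k).2, Subset.rfl⟩, ?_, ?_⟩
  · rintro _ ⟨k, rfl⟩
    exact (hP k).1
  · exact infinite_range_of_injective ((initSeg_injective _).comp hφ.injective)

/-- A set of strings with no infinite subset in the family is covered, up to a finite set, by
finitely many branches outside the range of `f`. -/
theorem exists_finite_cover_of_orthogonal {f : (ℕ → ℕ) → ℕ → Bool} {A : Set (List Bool)}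
    (hA : ∀ D ∈ branchFamily f, D ⊆ A → D.Finite) :
    ∃ Y : Set (ℕ → Bool), Y.Finite ∧ Y ⊆ (range f)ᶜ ∧ (A \ ⋃ y ∈ Y, branch y).Finite := by
  obtain ⟨Y, hY, hfin⟩ := exists_finite_branches_cover fun D hDA hD => hA D (Or.inl hD) hDA
  refine ⟨Y ∩ (range f)ᶜ, hY.inter_of_left _, inter_subset_right, ?_⟩
  have hfin' : (⋃ y ∈ Y ∩ range f, A ∩ branch y).Finite := by
    refine (hY.inter_of_left _).biUnion ?_
    rintro _ ⟨-, z, rfl⟩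
    by_contra hinf
    obtain ⟨D, hD, hDA, hDinf⟩ := exists_infinite_mem_sparseChains hinf
    exact hDinf (hA D (Or.inr hD) hDA)
  refine (hfin.union hfin').subset ?_
  rintro a ⟨haA, ha⟩
  by_cases hmem : a ∈ ⋃ y ∈ Y, branch y
  · obtain ⟨y, hy, hay⟩ := mem_iUnion₂.1 hmem
    refine Or.inr (mem_iUnion₂.2 ⟨y, ⟨hy, ?_⟩, haA, hay⟩)
    by_contra hyf
    exact ha (mem_iUnion₂.2 ⟨y, ⟨hy, hyf⟩, hay⟩)
  · exact Or.inl ⟨haA, hmem⟩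

/-- The traces on the branch `x` of the sparse chains given by sequences that extend the first `n`
values of `z`, with their first `n` possible elements omitted. -/
def chainTraces (f : (ℕ → ℕ) → ℕ → Bool) (x : ℕ → Bool) (z : ℕ → ℕ) (n : ℕ) : Set (Set ℕ) :=
  {L | ∃ w φ : ℕ → ℕ, (∀ k < n, w k = z k) ∧ StrictMono φ ∧ (∀ k, w k ≤ φ k) ∧ L ⊆ φ '' Ici n ∧
    ∀ m ∈ L, initSeg (f w) m = initSeg x m}

/-- A point p of a trace is some φ(k) with k ≥ n, so w(n) ≤ φ(n) ≤ p. Deleting φ(n) puts the trace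
in the family whose n-th value is w(n), as `Flattening.of_sdiff` requires. -/
theorem flattening_chainTraces_of_update {f : (ℕ → ℕ) → ℕ → Bool} {x : ℕ → Bool} {z : ℕ → ℕ}
    {n : ℕ} (h : ∀ i, Flattening (chainTraces f x (Function.update z n i) (n + 1))) :
    Flattening (chainTraces f x z n) := by
  refine Flattening.of_sdiff h ?_
  rintro L ⟨w, φ, hw, hφ, hwφ, hL, hLx⟩ p hp
  obtain ⟨k, hk, rfl⟩ := hL hp
  refine ⟨w n, (hwφ n).trans (hφ.monotone hk), φ n, hφ.monotone hk, w, φ, ?_, hφ, hwφ, ?_, ?_⟩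
  · intro j hj
    rcases Nat.lt_succ_iff_lt_or_eq.1 hj with hj | rfl
    · rw [Function.update_of_ne hj.ne, hw j hj]
    · rw [Function.update_self]
  · rintro m ⟨hm, hmn⟩
    obtain ⟨j, hj, rfl⟩ := hL hm
    refine ⟨j, Nat.succ_le_of_lt (lt_of_le_of_ne hj ?_), rfl⟩
    rintro rfl
    exact hmn rfl
  · exact fun m hm => hLx m hm.1

/-- Failure of flattening forces some trace to charge a vector supported in [M, ∞), so f(w) follows
x at least to length M. -/
theorem exists_initSeg_eq_of_not_flattening {f : (ℕ → ℕ) → ℕ → Bool} {x : ℕ → Bool} {z : ℕ → ℕ}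
    {n : ℕ} (h : ¬ Flattening (chainTraces f x z n)) (M : ℕ) :
    ∃ w : ℕ → ℕ, (∀ k < n, w k = z k) ∧ initSeg (f w) M = initSeg x M := by
  unfold Flattening at h
  push Not at h
  obtain ⟨u, hu, δ, hδ, huδ⟩ := h
  obtain ⟨L, ⟨w, φ, hw, -, -, -, hLx⟩, hL⟩ := huδ (u M) (subset_convexHull ℝ _ ⟨M, rfl⟩)
  refine ⟨w, hw, ?_⟩
  have : ∃ p ∈ L, u M p ≠ 0 := by
    by_contra! hcon
    rw [massOn_congr (D' := ∅) fun n hn => ⟨fun hnL => hn (hcon n hnL), fun h => h.elim⟩] at hL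
    simp [massOn_apply] at hL
    linarith
  obtain ⟨p, hpL, hp⟩ := this
  have hMp : M ≤ p := by
    by_contra! hlt
    exact hp ((hu M).2.2 p hlt)
  have := initSeg_eq_iff.1 (hLx p hpL)
  exact initSeg_eq_iff.2 fun k hk => this k (hk.trans_le hMp)

/-- A failure passes to some choice of the next value at every stage. The diagonal limit of these
choices is a preimage of x, by continuity. -/
theorem flattening_chainTraces {f : (ℕ → ℕ) → ℕ → Bool} (hf : Continuous f) {x : ℕ → Bool}
    (hx : x ∉ range f) (z : ℕ → ℕ) : Flattening (chainTraces f x z 0) := by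
  by_contra hbad
  have step : ∀ (z : ℕ → ℕ) (n : ℕ), ∃ i, ¬ Flattening (chainTraces f x z n) →
      ¬ Flattening (chainTraces f x (Function.update z n i) (n + 1)) := by
    intro z n
    by_contra! hcon
    exact (hcon 0).1 (flattening_chainTraces_of_update fun i => (hcon i).2)
  choose i hi using step
  let Z : ℕ → ℕ → ℕ := fun n => Nat.rec z (fun n z => Function.update z n (i z n)) n
  have hZ : ∀ n, Z (n + 1) = Function.update (Z n) n (i (Z n) n) := fun n => rfl
  have hZbad : ∀ n, ¬ Flattening (chainTraces f x (Z n) n) := by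
    intro n
    induction n with
    | zero => exact hbad
    | succ n ih => exact hi _ _ ih
  have hZeq : ∀ k n, k < n → Z n k = Z (k + 1) k := by
    intro k n hkn
    induction n, hkn using Nat.le_induction with
    | base => rfl
    | succ n hn ih => rw [hZ, Function.update_of_ne (by omega), ih]
  refine hx ⟨fun k => Z (k + 1) k, ?_⟩
  funext M
  obtain ⟨n, hn⟩ := hf.exists_initSeg_eq (fun k => Z (k + 1) k) (M + 1)
  obtain ⟨w, hw, hwx⟩ := exists_initSeg_eq_of_not_flattening (hZbad n) (M + 1)
  have := hn w fun k hk => (hw k hk).trans (hZeq k n hk)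
  exact initSeg_eq_iff.1 (this.symm.trans hwx) M (Nat.lt_succ_self M)

/-- Outside the range of `f`, the traces of the family on a branch are flattening. -/
theorem flattening_preimage_branchFamily {f : (ℕ → ℕ) → ℕ → Bool} (hf : Continuous f)
    {x : ℕ → Bool} (hx : x ∉ range f) :
    Flattening ((fun D => initSeg x ⁻¹' D) '' branchFamily f) := by
  refine (flattening_subsingleton.union (flattening_chainTraces hf hx 0)).mono ?_
  rintro _ ⟨D, hD | ⟨z, φ, hφ, hz, hD⟩, rfl⟩
  · left
    intro m hm n hn
    refine initSeg_injective x ?_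
    rcases le_total m n with h | h
    · exact IsAntichain.eq hD hm hn (initSeg_prefix x h)
    · exact (IsAntichain.eq hD hn hm (initSeg_prefix x h)).symm
  · right
    refine ⟨z, φ, by simp, hφ, hz, fun m hm => ?_, fun m hm => ?_⟩
    · obtain ⟨k, hk⟩ := hD hm
      exact ⟨k, Nat.zero_le k, initSeg_eq_of_eq hk⟩
    · obtain ⟨k, hk⟩ := hD hm
      obtain rfl := initSeg_eq_of_eq hk
      exact hk

end BranchFamilies

open scoped ENNReal

/-! ### Relatively weakly compact sets. -/

section WeakCompactness

variable {X : Type*} [NormedAddCommGroup X] [NormedSpace ℝ X]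

theorem IsRelWeaklyCompact.mono {A B : Set X} (hB : IsRelWeaklyCompact B) (h : A ⊆ B) :
    IsRelWeaklyCompact A :=
  IsCompact.of_isClosed_subset hB isClosed_closure (closure_mono (image_mono h))

theorem IsRelWeaklyCompact.union {A B : Set X} (hA : IsRelWeaklyCompact A)
    (hB : IsRelWeaklyCompact B) : IsRelWeaklyCompact (A ∪ B) := by
  unfold IsRelWeaklyCompact
  rw [image_union, closure_union]
  exact IsCompact.union hA hB

theorem Set.Finite.isRelWeaklyCompact {A : Set X} (hA : A.Finite) : IsRelWeaklyCompact A :=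
  (hA.image _).isCompact.closure

theorem Set.Finite.isRelWeaklyCompact_biUnion {ι : Type*} {s : Set ι} (hs : s.Finite)
    {A : ι → Set X} (hA : ∀ i ∈ s, IsRelWeaklyCompact (A i)) :
    IsRelWeaklyCompact (⋃ i ∈ s, A i) := by
  induction s, hs using Set.Finite.induction_on with
  | empty => simpa using Set.finite_empty.isRelWeaklyCompact
  | insert _ _ ih =>
    rw [biUnion_insert]
    exact (hA _ (mem_insert _ _)).union (ih fun i hi => hA i (mem_insert_of_mem _ hi))

/-- The range of a weakly null sequence is relatively weakly compact. -/
theorem isRelWeaklyCompact_range_of_weaklyNull {x : ℕ → X}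
    (hx : ∀ g : X →L[ℝ] ℝ, Tendsto (fun n => g (x n)) atTop (𝓝 0)) :
    IsRelWeaklyCompact (range x) := by
  have hlim : Tendsto (fun n => toWeakSpace ℝ X (x n)) atTop (𝓝 (toWeakSpace ℝ X 0)) := by
    refine (WeakBilin.tendsto_iff_forall_eval_tendsto (B := (topDualPairing ℝ X).flip) ?_).2 ?_
    · intro a b h
      by_contra hne
      obtain ⟨g, hg⟩ := SeparatingDual.exists_separating_of_ne (R := ℝ) hne
      exact hg (DFunLike.congr_fun h g)
    · intro g
      have := hx g
      rw [← map_zero g] at this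
      exact this
  refine hlim.isCompact_insert_range.closure_of_subset ?_
  rintro _ ⟨_, ⟨n, rfl⟩, rfl⟩
  exact mem_insert_of_mem _ ⟨n, rfl⟩

end WeakCompactness

/-! ### The Banach space normed by a family of index sets. -/

section FamilyBases

variable {ι : Type} (𝒜 : Set (Set ι))

/-- A system of vectors `e i` with dense span in a normed space whose norm is the supremum of the
absolute values of the functionals `eval D`, `D ∈ 𝒜`, which map a combination of the `e i` to the
sum of its coefficients over `D`. -/
structure FamilySystem (X : Type*) [NormedAddCommGroup X] [NormedSpace ℝ X] where
  /-- The vectors of the system. -/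
  e : ι → X
  /-- The norming functionals. -/
  eval : 𝒜 → X →L[ℝ] ℝ
  eval_e : ∀ (D : 𝒜) (i : ι), eval D (e i) = (D : Set ι).indicator 1 i
  abs_eval_le : ∀ (D : 𝒜) (x : X), |eval D x| ≤ ‖x‖
  norm_le : ∀ (x : X) (c : ℝ), 0 ≤ c → (∀ D, |eval D x| ≤ c) → ‖x‖ ≤ c
  dense_span : (Submodule.span ℝ (range e)).topologicalClosure = ⊤

/-- The element of `ℓ^∞(𝒜)` that tells which members of `𝒜` contain `i`. -/
noncomputable def memVec (i : ι) : lp (fun _ : 𝒜 => ℝ) ∞ :=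
  ⟨fun D => (D : Set ι).indicator 1 i, memℓp_infty ⟨1, by
    rintro _ ⟨D, rfl⟩
    by_cases h : i ∈ (D : Set ι) <;> simp [h]⟩⟩

/-- The closed span of the vectors `memVec 𝒜 i` in `ℓ^∞(𝒜)`. -/
noncomputable abbrev FamilySpace : Submodule ℝ (lp (fun _ : 𝒜 => ℝ) ∞) :=
  (Submodule.span ℝ (range (memVec 𝒜))).topologicalClosure

instance : CompleteSpace (FamilySpace 𝒜) :=
  (Submodule.isClosed_topologicalClosure _).completeSpace_coe

theorem topologicalClosure_span_range_codRestrict {V : Type*} [NormedAddCommGroup V]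
    [NormedSpace ℝ V] (e : ι → V) (p : Submodule ℝ V)
    (hp : p = (Submodule.span ℝ (range e)).topologicalClosure) (he : ∀ i, e i ∈ p) :
    (Submodule.span ℝ (range fun i => (⟨e i, he i⟩ : p))).topologicalClosure = ⊤ := by
  rw [eq_top_iff]
  rintro ⟨x, hx⟩ -
  change _ ∈ closure _
  rw [closure_subtype]
  have himage : (Subtype.val '' (Submodule.span ℝ (range fun i => (⟨e i, he i⟩ : p)) : Set p)) =
      (Submodule.span ℝ (range e) : Set V) := by
    have := Submodule.map_span p.subtype (range fun i => (⟨e i, he i⟩ : p))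
    rw [← range_comp] at this
    exact congrArg (fun q : Submodule ℝ V => (q : Set V)) this
  have hx' : x ∈ closure (Submodule.span ℝ (range e) : Set V) := by
    rwa [hp] at hx
  rwa [← himage] at hx'

/-- The system of the vectors `memVec 𝒜 i` in their closed span. -/
noncomputable def familySystem : FamilySystem 𝒜 (FamilySpace 𝒜) where
  e i := ⟨memVec 𝒜 i, Submodule.le_topologicalClosure _ (Submodule.subset_span ⟨i, rfl⟩)⟩
  eval D := (lp.evalCLM ℝ (fun _ : 𝒜 => ℝ) ∞ D).comp (FamilySpace 𝒜).subtypeL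
  eval_e _ _ := rfl
  abs_eval_le D x := lp.norm_apply_le_norm ENNReal.top_ne_zero (x : lp (fun _ : 𝒜 => ℝ) ∞) D
  norm_le _ _ hc h := lp.norm_le_of_forall_le hc h
  dense_span := topologicalClosure_span_range_codRestrict (memVec 𝒜) _ rfl _

variable {𝒜} {X : Type*} [NormedAddCommGroup X] [NormedSpace ℝ X]

namespace FamilySystem

variable (Φ : FamilySystem 𝒜 X)

theorem norm_e (hs : ∀ i, {i} ∈ 𝒜) (i : ι) : ‖Φ.e i‖ = 1 := by
  refine le_antisymm (Φ.norm_le _ 1 zero_le_one fun D => ?_) ?_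
  · rw [Φ.eval_e]
    by_cases h : i ∈ (D : Set ι) <;> simp [h]
  · simpa [Φ.eval_e] using Φ.abs_eval_le ⟨{i}, hs i⟩ (Φ.e i)

theorem e_injective (hs : ∀ i, {i} ∈ 𝒜) : Function.Injective Φ.e := by
  intro i j h
  have := congrArg (Φ.eval ⟨{i}, hs i⟩) h
  by_contra hne
  simp [Φ.eval_e, Ne.symm hne] at this

theorem isNormalizedUnconditionalBasis [Infinite ι] [Countable ι] (hs : ∀ i, {i} ∈ 𝒜)
    (hm : ∀ D ∈ 𝒜, ∀ D' ⊆ D, D' ∈ 𝒜) : IsNormalizedUnconditionalBasis (range Φ.e) where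
  infinite := infinite_range_of_injective (Φ.e_injective hs)
  countable := countable_range _
  ne_zero := by
    rintro _ ⟨i, rfl⟩ h
    simpa [h] using Φ.norm_e hs i
  unconditional := by
    refine ⟨1, one_pos, fun G F hGF hF α => ?_⟩
    rw [one_mul]
    refine Φ.norm_le _ _ (norm_nonneg _) fun D => ?_
    -- Restricting the sum to G amounts to shrinking D, so a hereditary family gives the constant 1.
    have hD' : (D : Set ι) ∩ {i | Φ.e i ∈ G} ∈ 𝒜 := hm _ D.2 _ inter_subset_left
    convert Φ.abs_eval_le ⟨_, hD'⟩ (∑ x ∈ F, α x • x) using 2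
    classical
    simp only [map_sum, map_smul, smul_eq_mul]
    rw [← Finset.sum_subset hGF]
    · refine Finset.sum_congr rfl fun x hx => ?_
      obtain ⟨i, rfl⟩ := hF (hGF hx)
      rw [Φ.eval_e, Φ.eval_e]
      simp [indicator_apply, hx]
    · intro x hxF hxG
      obtain ⟨i, rfl⟩ := hF hxF
      rw [Φ.eval_e]
      simp [hxG]
  dense_span := Φ.dense_span
  norm_eq_one := by
    rintro _ ⟨i, rfl⟩
    exact Φ.norm_e hs i

/-- An infinite member of the family indexes a set which is not relatively weakly compact. -/
theorem finite_of_isRelWeaklyCompact (hm : ∀ D ∈ 𝒜, ∀ D' ⊆ D, D' ∈ 𝒜) {D : Set ι} (hD : D ∈ 𝒜)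
    (hc : IsRelWeaklyCompact (Φ.e '' D)) : D.Finite := by
  by_contra hinf
  have : NeBot (cofinite ⊓ 𝓟 D) := cofinite_inf_principal_neBot_iff.2 hinf
  obtain ⟨w, -, hw⟩ := hc (f := map (fun i => toWeakSpace ℝ X (Φ.e i)) (cofinite ⊓ 𝓟 D)) (by
    rw [le_principal_iff, mem_map]
    refine mem_of_superset (mem_inf_of_right (mem_principal_self D)) fun i hi => ?_
    exact subset_closure ⟨_, ⟨i, hi, rfl⟩, rfl⟩)
  obtain ⟨x, rfl⟩ := (toWeakSpace ℝ X).surjective w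
  -- The cluster point x keeps mass 1 on D after any finite deletion. Deleting the support of a
  -- finite combination shows that x is at distance at least 1 from it, against density of the span.
  have hx : ∀ F : Finset ι, Φ.eval ⟨D \ F, hm D hD _ sdiff_subset⟩ x = 1 := by
    intro F
    set g := Φ.eval ⟨D \ F, hm D hD _ sdiff_subset⟩
    have hg : Continuous fun y : WeakSpace ℝ X => g ((toWeakSpace ℝ X).symm y) :=
      WeakBilin.eval_continuous (topDualPairing ℝ X).flip g
    have hcl : ClusterPt (g x) (𝓟 {1}) := by
      refine (hw.map hg.continuousAt tendsto_map).mono ?_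
      rw [le_principal_iff, mem_map, mem_map]
      have h₁ : (F : Set ι)ᶜ ∈ cofinite ⊓ 𝓟 D := mem_inf_of_left F.finite_toSet.compl_mem_cofinite
      have h₂ : D ∈ cofinite ⊓ 𝓟 D := mem_inf_of_right (mem_principal_self D)
      filter_upwards [h₁, h₂] with i hi hiD
      have : g (Φ.e i) = 1 := by
        rw [Φ.eval_e]
        exact indicator_of_mem (show i ∈ D \ F from ⟨hiD, hi⟩) 1
      exact this
    simpa using mem_closure_iff_clusterPt.2 hcl
  have hxcl : x ∈ closure (Submodule.span ℝ (range Φ.e) : Set X) := by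
    rw [← Submodule.topologicalClosure_coe, Φ.dense_span]
    trivial
  obtain ⟨v, hv, hxv⟩ := Metric.mem_closure_iff.1 hxcl 1 one_pos
  obtain ⟨c, rfl⟩ := Finsupp.mem_span_range_iff_exists_finsupp.1 hv
  have h₁ := Φ.abs_eval_le ⟨D \ c.support, hm D hD _ sdiff_subset⟩ (x - c.sum fun i a => a • Φ.e i)
  have h₂ : Φ.eval ⟨D \ c.support, hm D hD _ sdiff_subset⟩ (c.sum fun i a => a • Φ.e i) = 0 := by
    simp only [Finsupp.sum, map_sum, map_smul, Φ.eval_e]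
    refine Finset.sum_eq_zero fun i hi => ?_
    rw [indicator_of_notMem (fun h => h.2 hi), smul_zero]
  rw [map_sub, hx, h₂, sub_zero, abs_one, ← dist_eq_norm] at h₁
  exact h₁.not_gt hxv

theorem eval_linearCombination (s : ℕ → ι) (v : ℕ →₀ ℝ) (D : 𝒜) :
    Φ.eval D (Finsupp.linearCombination ℝ (fun n => Φ.e (s n)) v) = massOn (s ⁻¹' D) v := by
  rw [massOn_apply, Finsupp.linearCombination_apply, Finsupp.sum, map_sum]
  refine Finset.sum_congr rfl fun n _ => ?_
  rw [map_smul, Φ.eval_e]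
  rfl

/-- The bound g ≥ ε persists under convex combinations, while flattening makes one of them have norm
at most ε/(‖g‖ + 1). -/
theorem not_frequently_le_of_flattening {s : ℕ → ι}
    (hs : Flattening ((fun D => s ⁻¹' D) '' 𝒜)) (g : X →L[ℝ] ℝ) {ε : ℝ} (hε : 0 < ε) :
    ¬ ∃ᶠ n in atTop, ε ≤ g (Φ.e (s n)) := by
  intro hfr
  obtain ⟨ψ, hψ, hψg⟩ := extraction_of_frequently_atTop hfr
  have hu : ∀ M, Finsupp.single (ψ M) (1 : ℝ) ∈ probFrom M := by
    intro M
    refine ⟨Finsupp.single_nonneg.2 zero_le_one, by simp [massOn_single], fun n hn => ?_⟩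
    exact Finsupp.single_eq_of_ne (hn.trans_le (hψ.id_le M)).ne
  have hδ : 0 < ε / (‖g‖ + 1) := by positivity
  obtain ⟨v, hv, hvD⟩ := hs _ hu _ hδ
  set x := Finsupp.linearCombination ℝ (fun n => Φ.e (s n)) v with hxdef
  have hv0 : 0 ≤ v :=
    (convexHull_range_subset_probFrom (fun n => probFrom_anti (Nat.zero_le n) (hu n)) hv).1
  have hx : ‖x‖ ≤ ε / (‖g‖ + 1) := by
    refine Φ.norm_le _ _ hδ.le fun D => ?_
    rw [hxdef, Φ.eval_linearCombination, abs_of_nonneg (massOn_nonneg hv0 _)]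
    exact hvD _ ⟨D, D.2, rfl⟩
  have hgx : ε ≤ g x := by
    have hconv : Convex ℝ {v : ℕ →₀ ℝ |
        ε ≤ ((g : X →ₗ[ℝ] ℝ) ∘ₗ Finsupp.linearCombination ℝ fun n => Φ.e (s n)) v} :=
      convex_halfSpace_ge (LinearMap.isLinear _) ε
    refine convexHull_min (range_subset_iff.2 fun M => ?_) hconv hv
    simpa using hψg M
  have hle : g x ≤ ‖g‖ * (ε / (‖g‖ + 1)) :=
    (le_abs_self _).trans ((g.le_opNorm x).trans (by gcongr))
  have : ‖g‖ * (ε / (‖g‖ + 1)) < ε := by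
    rw [mul_div_assoc', div_lt_iff₀ (by positivity)]
    nlinarith [norm_nonneg g]
  linarith

/-- If the traces of the family on a sequence of indices are flattening, then the corresponding
vectors form a relatively weakly compact set. -/
theorem isRelWeaklyCompact_of_flattening {s : ℕ → ι}
    (hs : Flattening ((fun D => s ⁻¹' D) '' 𝒜)) : IsRelWeaklyCompact (Φ.e '' range s) := by
  rw [← range_comp]
  refine isRelWeaklyCompact_range_of_weaklyNull fun g => ?_
  refine Metric.tendsto_nhds.2 fun ε hε => ?_
  have h₁ := not_frequently.1 (Φ.not_frequently_le_of_flattening hs g hε)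
  have h₂ := not_frequently.1 (Φ.not_frequently_le_of_flattening hs (-g) hε)
  filter_upwards [h₁, h₂] with n hn₁ hn₂
  simp only [not_le, neg_apply] at hn₁ hn₂
  rw [Real.dist_eq, sub_zero, abs_lt]
  exact ⟨by simpa using neg_lt.1 hn₂, hn₁⟩

end FamilySystem

end FamilyBases

/-! ### The basis indexed by the binary tree, and the Tukey type of its compact sets. -/

section BranchBasis

theorem ExistsCoanalyticAlephOne.exists_continuous (h : ExistsCoanalyticAlephOne) :
    ∃ f : (ℕ → ℕ) → ℕ → Bool, Continuous f ∧
      Cardinal.mk ((range f)ᶜ : Set (ℕ → Bool)) = Cardinal.aleph 1 := by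
  obtain ⟨E, hE, hcard⟩ := h
  unfold IsCoanalytic at hE
  rw [MeasureTheory.AnalyticSet] at hE
  rcases hE with hE | ⟨f, hf, hfE⟩
  · rw [compl_empty_iff] at hE
    subst hE
    rw [Cardinal.mk_univ] at hcard
    refine ⟨fun _ _ => false, continuous_const, ?_⟩
    rw [range_const, Cardinal.mk_compl_of_infinite, hcard]
    rw [hcard, Cardinal.mk_singleton]
    exact Cardinal.one_lt_aleph0.trans_le (Cardinal.aleph0_le_aleph 1)
  · exact ⟨f, hf, by rw [hfE, compl_compl, hcard]⟩

/-- If the relatively weakly compact subsets of a basis indexed by the binary tree are, up to finite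
sets, those covered by finitely many of the branches `σ i`, they form a poset Tukey equivalent to
the finite sets of indices. -/
theorem tukeyEquiv_finset_of_branches {X : Type*} [NormedAddCommGroup X] [NormedSpace ℝ X]
    {I : Type*} [Infinite I] {σ : I → ℕ → Bool} (hσ : Function.Injective σ) {e : List Bool → X}
    (hc : ∀ i, IsRelWeaklyCompact (e '' branch (σ i)))
    (hcover : ∀ S, IsRelWeaklyCompact (e '' S) →
      ∃ F : Finset I, (S \ ⋃ i ∈ F, branch (σ i)).Finite) :
    TukeyEquiv (RK (range e)) (Finset I) := by
  classical
  have hidx : ∀ A : RK (range e), e '' (e ⁻¹' A.1) = A.1 := fun A =>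
    image_preimage_eq_of_subset A.2.1
  have hcov : ∀ A : RK (range e), ∃ F : Finset I,
      (e ⁻¹' A.1 \ ⋃ i ∈ F, branch (σ i)).Finite := fun A =>
    hcover _ (by rw [hidx]; exact A.2.2)
  choose F hF using hcov
  have hbr : ∀ G : Finset I, IsRelWeaklyCompact (e '' ⋃ i ∈ G, branch (σ i)) := fun G => by
    rw [image_iUnion₂]
    exact G.finite_toSet.isRelWeaklyCompact_biUnion fun i _ => hc i
  -- Strings are coded as indices so that the finite uncovered remainder is recorded in the same
  -- finite set as the branches.
  obtain ⟨c⟩ : Nonempty (List Bool ↪ I) :=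
    ⟨(Encodable.encode' (List Bool)).trans (Infinite.natEmbedding I)⟩
  refine ⟨⟨fun A => F A ∪ (hF A).toFinset.image c, fun G => ?_⟩,
    ⟨fun G => ⟨_, image_subset_range _ _, hbr G⟩, fun A => ⟨F A, fun G hG i hi => ?_⟩⟩⟩
  · have hfin : (c ⁻¹' (G : Set I)).Finite := G.finite_toSet.preimage c.injective.injOn
    refine ⟨⟨e '' (⋃ i ∈ G, branch (σ i)) ∪ e '' (c ⁻¹' G), ?_,
      (hbr G).union (hfin.image e).isRelWeaklyCompact⟩, fun A hA => ?_⟩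
    · exact union_subset (image_subset_range _ _) (image_subset_range _ _)
    · change A.1 ⊆ e '' (⋃ i ∈ G, branch (σ i)) ∪ e '' (c ⁻¹' G)
      rw [← hidx A, ← image_union]
      refine image_mono fun a ha => ?_
      obtain ⟨h₁, h₂⟩ := Finset.union_subset_iff.1 hA
      by_cases hmem : a ∈ ⋃ i ∈ F A, branch (σ i)
      · obtain ⟨i, hi, hai⟩ := mem_iUnion₂.1 hmem
        exact Or.inl (mem_iUnion₂.2 ⟨i, h₁ hi, hai⟩)
      · exact Or.inr (h₂ (Finset.mem_image_of_mem c ((hF A).mem_toFinset.2 ⟨ha, hmem⟩)))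
  -- If i were missing from `F A`, the infinite branch `σ i` would lie in a finite remainder
  -- together with finitely many finite intersections.
  · by_contra hiF
    have hsub : branch (σ i) ⊆ e ⁻¹' A.1 := fun a ha =>
      hG ⟨a, mem_iUnion₂.2 ⟨i, hi, ha⟩, rfl⟩
    have hfin : (⋃ j ∈ F A, branch (σ i) ∩ branch (σ j)).Finite :=
      (F A).finite_toSet.biUnion fun j hj => branch_inter_branch_finite (hσ.ne (by
        rintro rfl
        exact hiF hj))
    refine branch_infinite (σ i) (((hF A).union hfin).subset fun a ha => ?_)
    by_cases hmem : a ∈ ⋃ j ∈ F A, branch (σ j)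
    · obtain ⟨j, hj, haj⟩ := mem_iUnion₂.1 hmem
      exact Or.inr (mem_iUnion₂.2 ⟨j, hj, ha, haj⟩)
    · exact Or.inl ⟨hsub ha, hmem⟩

theorem ExistsCoanalyticAlephOne.exists_basis (h : ExistsCoanalyticAlephOne) :
    ∃ (X : Type) (_ : NormedAddCommGroup X) (_ : NormedSpace ℝ X) (_ : CompleteSpace X)
      (B : Set X), IsNormalizedUnconditionalBasis B ∧
        TukeyEquiv (RK B) (FinSubsets (Cardinal.aleph 1)) := by
  obtain ⟨f, hf, hcard⟩ := h.exists_continuous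
  let Φ := familySystem (branchFamily f)
  have hs := singleton_mem_branchFamily f
  have hm : ∀ D ∈ branchFamily f, ∀ D' ⊆ D, D' ∈ branchFamily f :=
    fun D hD D' h => branchFamily_mono hD h
  have hI : Cardinal.mk {α : Ordinal.{0} // α < (Cardinal.aleph 1).ord} =
      Cardinal.lift.{1} (Cardinal.mk ((range f)ᶜ : Set (ℕ → Bool))) := by
    rw [mk_ordinals_lt_ord, hcard]
  obtain ⟨τ⟩ := Cardinal.lift_mk_eq'.1 ((Cardinal.lift_id'.{0, 1} _).trans hI)
  have : Infinite {α : Ordinal.{0} // α < (Cardinal.aleph 1).ord} := by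
    rw [Cardinal.infinite_iff, hI, hcard]
    simp
  refine ⟨FamilySpace (branchFamily f), inferInstance, inferInstance, inferInstance, range Φ.e,
    Φ.isNormalizedUnconditionalBasis hs hm,
    tukeyEquiv_finset_of_branches (σ := fun i => (τ i : ℕ → Bool))
      (Subtype.val_injective.comp τ.injective) (fun i => ?_) fun S hS => ?_⟩
  · exact Φ.isRelWeaklyCompact_of_flattening (flattening_preimage_branchFamily hf (τ i).2)
  · obtain ⟨Y, hY, hYf, hfin⟩ := exists_finite_cover_of_orthogonal (f := f) (A := S)
      fun D hD hDS => Φ.finite_of_isRelWeaklyCompact hm hD (hS.mono (image_mono hDS))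
    have hpre : ((fun i => (τ i : ℕ → Bool)) ⁻¹' Y).Finite :=
      hY.preimage (Subtype.val_injective.comp τ.injective).injOn
    refine ⟨hpre.toFinset, hfin.subset (sdiff_subset_sdiff_right ?_)⟩
    refine iUnion₂_subset fun y hy a ha => ?_
    refine mem_iUnion₂.2 ⟨τ.symm ⟨y, hYf hy⟩, ?_, ?_⟩
    · simpa using hy
    · simpa using ha

end BranchBasis

theorem mainTheorem10 :
    (ExistsCoanalyticAlephOne →
      ∃ (X : Type) (_ : NormedAddCommGroup X) (_ : NormedSpace ℝ X) (_ : CompleteSpace X)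
        (B : Set X), IsNormalizedUnconditionalBasis B ∧
          TukeyEquiv (RK B) (FinSubsets (Cardinal.aleph 1))) ∧
    (MartinAxiomAlephOne → LusinHypothesis →
      ExistsCoanalyticAlephOne ∧
      ∀ (X : Type u) [NormedAddCommGroup X] [NormedSpace ℝ X] [CompleteSpace X] (B : Set X),
        IsNormalizedUnconditionalBasis B →
          TukeyEquiv (RK B) (FinSubsets (Cardinal.aleph 1)) → ¬ IsTukeyCanonical (RK B)) :=
  ⟨fun h => h.exists_basis, fun hMA hL => ⟨hL.existsCoanalyticAlephOne,
    fun _ _ _ _ _ _ h => not_isTukeyCanonical_of_tukeyEquiv hMA h⟩⟩
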